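/- Let $\lambda$ be a regular cardinal. A category $\mathcal K$ is called $\lambda$-accessible if it has $\lambda$-directed colimits and has a set $\mathcal A$ of $\lambda$-presentable objects such that every object of $\mathcal K$ is a $\lambda$-directed colimit of objects from $\mathcal A$; it is accessible if it is $\lambda$-accessible for some regular cardinal $\lambda$. A full subcategory $\mathcal L$ of an accessible category $\mathcal K$ is called accessibly embedded if there is a regular cardinal $\lambda$ such that $\mathcal L$ is closed under $\lambda$-directed colimits in $\mathcal K$, i.e. every object of $\mathcal K$ that is a colimit in $\mathcal K$ of a $\lambda$-directed diagram of objects of $\mathcal L$ belongs to $\mathcal L$. Proposition. Let $\mathcal K$ be an accessible category, and let $(\mathcal L_i)_{i\in I}$ be a family, indexed by a set $I$, of full subcategories of $\mathcal K$ each of which is accessible and accessibly embedded in $\mathcal K$. Then the union of the $\mathcal L_i$, that is, the full subcategory of $\mathcal K$ consisting of all objects that belong to $\mathcal L_i$ for some $i\in I$, is accessible and accessibly embedded in $\mathcal K$. -/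

import Mathlib

universe w v u

namespace CategoryTheory.ObjectProperty

/-- A full subcategory of `C`, given by the property `P` of its objects, is accessibly embedded
if, for some regular cardinal `κ`, it is closed under `κ`-filtered colimits in `C`: every object
of `C` which is the colimit in `C` of a small `κ`-filtered diagram of objects satisfying `P`
satisfies `P` (in particular, `P` is closed under isomorphisms).
As in the definition of accessible categories, `κ`-filtered small categories are used as index
categories; `isAccessiblyEmbedded_iff_directed` says that `κ`-directed posets give the same
notion. -/
def IsAccessiblyEmbedded {C : Type u} [Category.{v} C] (P : ObjectProperty C) : Prop :=
  ∃ (κ : Cardinal.{w}) (_ : Fact κ.IsRegular),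
    ∀ (J : Type w) [SmallCategory J] [IsCardinalFiltered J κ], P.IsClosedUnderColimitsOfShape J

/-- It is equivalent to require closure under colimits indexed by `κ`-directed posets. -/
lemma isAccessiblyEmbedded_iff_directed {C : Type u} [Category.{v} C] (P : ObjectProperty C) :
    IsAccessiblyEmbedded.{w} P ↔
      ∃ (κ : Cardinal.{w}) (_ : Fact κ.IsRegular),
        ∀ (J : Type w) [PartialOrder J] [IsCardinalFiltered J κ],
          P.IsClosedUnderColimitsOfShape J := by
  constructor
  · rintro ⟨κ, hκ, h⟩
    exact ⟨κ, hκ, fun J _ _ ↦ h J⟩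
  · rintro ⟨κ, hκ, h⟩
    refine ⟨κ, hκ, fun J _ _ ↦ ⟨?_⟩⟩
    obtain ⟨α, _, _, F, _⟩ := IsCardinalFiltered.exists_cardinal_directed J κ
    exact (P.colimitsOfShape_le_of_final F).trans (h α).colimitsOfShape_le

end CategoryTheory.ObjectProperty

open CategoryTheory

open CategoryTheory Limits

/-! ### Cardinal arithmetic for the choice of `μ` -/

namespace Cardinal

/-! Each `L i` is closed under `κ i`-filtered colimits in the ambient category, for some `κ i` such
that its objects are `κ i`-filtered colimits there of objects from an essentially small `P i ≤ L i`
(`exists_essentiallySmall`). Take `μ = (2 ^ c)⁺` with `c` infinite and large.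

Closure: since `μ` exceeds the number of indices, a `μ`-directed diagram in the union has a cofinal
subdiagram in a single `L i`, which contains its colimit.

Generation: `exists_colimitsOfShape_regroup` rewrites a `κ i`-filtered colimit of objects of `P i`
as a `μ`-filtered colimit of `μ`-small `κ i`-filtered ones. These stay in `L i`, and are
`μ`-presentable because `P i` consists of `μ`-presentable objects. They form an essentially small
generator of the union. -/

lemma isRegular_succ_two_power (c : Cardinal.{w}) :
    (Order.succ ((2 : Cardinal.{w}) ^ max c ℵ₀)).IsRegular :=
  isRegular_succ ((le_max_right c ℵ₀).trans (cantor _).le)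

lemma lt_succ_two_power (c : Cardinal.{w}) : c < Order.succ (2 ^ max c ℵ₀) :=
  ((le_max_left c ℵ₀).trans_lt (cantor _)).trans (Order.lt_succ _)

/-- If `μ` is the successor of `2 ^ max c ℵ₀`, then any type `X` of cardinality `< μ` has fewer
than `μ` subsets of cardinality `< κ` for `κ ≤ c`. -/
lemma hasCardinalLT_setCardinalLT_succ_two_power {κ c : Cardinal.{w}} (h : κ ≤ c)
    {X : Type w} (hX : HasCardinalLT X (Order.succ (2 ^ max c ℵ₀))) :
    HasCardinalLT (CardinalDirectedPoset.SetCardinalLT κ X) (Order.succ (2 ^ max c ℵ₀)) := by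
  rw [hasCardinalLT_iff_cardinal_mk_lt, Order.lt_succ_iff] at hX ⊢
  have hc : ℵ₀ ≤ max c ℵ₀ := le_max_right _ _
  have hinj : mk (CardinalDirectedPoset.SetCardinalLT κ X) ≤
      mk { S : Set X // mk S ≤ max c ℵ₀ } :=
    mk_subtype_mono fun S hS ↦
      ((hasCardinalLT_iff_cardinal_mk_lt _ _).1 hS).le.trans (h.trans (le_max_left _ _))
  calc
    _ ≤ _ := hinj
    _ ≤ max (mk X) ℵ₀ ^ max c ℵ₀ := mk_bounded_set_le _ _
    _ ≤ (2 ^ max c ℵ₀) ^ max c ℵ₀ :=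
      power_le_power_right (max_le hX (hc.trans (cantor _).le))
    -- This absorption is why `μ` is the successor of a power of 2.
    _ = 2 ^ max c ℵ₀ := by rw [← power_mul, mul_eq_self hc]

end Cardinal

/-! ### Regrouping a colimit along small directed subsets -/

namespace CategoryTheory

variable {C : Type u} [Category.{v} C]

/-- The `κ`-directed subsets of cardinality `< μ` of a partially ordered type. -/
abbrev DirectedSubset (J : Type w) [PartialOrder J] (κ μ : Cardinal.{w}) [Fact κ.IsRegular] :
    Type w :=
  { S : Set J // IsCardinalFiltered S κ ∧ HasCardinalLT S μ }

namespace DirectedSubset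

variable {J : Type w} [PartialOrder J] {κ μ : Cardinal.{w}} [Fact κ.IsRegular]

instance (S : DirectedSubset J κ μ) : IsCardinalFiltered S.1 κ := S.2.1

lemma isCardinalFiltered [Fact μ.IsRegular]
    (hJ : ∀ A : Set J, HasCardinalLT A μ →
      ∃ B : Set J, A ⊆ B ∧ IsCardinalFiltered B κ ∧ HasCardinalLT B μ) :
    IsCardinalFiltered (DirectedSubset J κ μ) μ :=
  isCardinalFiltered_preorder _ _ fun K S hK ↦ by
    rw [← hasCardinalLT_iff_cardinal_mk_lt] at hK
    obtain ⟨B, hB, h₁, h₂⟩ :=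
      hJ (⋃ k, (S k).1) (hasCardinalLT_iUnion _ hK fun k ↦ (S k).2.2)
    exact ⟨⟨B, h₁, h₂⟩, fun k ↦ (Set.subset_iUnion (fun k ↦ (S k).1) k).trans hB⟩

lemma hasCardinalLT_arrow [Fact μ.IsRegular] (S : DirectedSubset J κ μ) : HasCardinalLT (Arrow S.1) μ :=
  (hasCardinalLT_prod (Cardinal.IsRegular.aleph0_le Fact.out) S.2.2 S.2.2).of_injective
    (fun f ↦ (f.left, f.right)) (by
      rintro ⟨a, b, f⟩ ⟨a', b', f'⟩ h
      obtain ⟨rfl, rfl⟩ := Prod.mk.inj h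
      obtain rfl := Subsingleton.elim f f'
      rfl)

variable [HasCardinalFilteredColimits C κ] (F : J ⥤ C)

/-- The restriction of a functor to a subset. -/
@[simps]
def restrict (S : Set J) : S ⥤ C where
  obj j := F.obj j.1
  map f := F.map (homOfLE (leOfHom f))
  map_comp f g := by rw [← F.map_comp]; rfl

instance (S : DirectedSubset J κ μ) : HasColimit (restrict F S.1) :=
  have := HasCardinalFilteredColimits.hasColimitsOfShape C (κ := κ) S.1
  inferInstance

/-- The morphism between colimits induced by an inclusion of `κ`-directed subsets. -/
noncomputable def colimitMap {S T : DirectedSubset J κ μ} (h : S ≤ T) :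
    colimit (restrict F S.1) ⟶ colimit (restrict F T.1) :=
  colimit.desc (restrict F S.1)
    { pt := colimit (restrict F T.1)
      ι.app j := colimit.ι (restrict F T.1) ⟨j.1, h j.2⟩
      ι.naturality i j g := by
        have := colimit.w (restrict F T.1) (j' := ⟨i.1, h i.2⟩)
          (j := ⟨j.1, h j.2⟩) (homOfLE (leOfHom g))
        exact this.trans (Category.comp_id _).symm }

lemma ι_colimitMap {S T : DirectedSubset J κ μ} (h : S ≤ T) (j : S.1) :
    colimit.ι (restrict F S.1) j ≫ colimitMap F h = colimit.ι (restrict F T.1) ⟨j.1, h j.2⟩ :=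
  colimit.ι_desc _ _

lemma colimitMap_comp {S T U : DirectedSubset J κ μ} (h : S ≤ T) (h' : T ≤ U) :
    colimitMap F h ≫ colimitMap F h' = colimitMap F (h.trans h') :=
  colimit.hom_ext fun j ↦ by
    rw [ι_colimitMap, ← Category.assoc, ι_colimitMap]
    exact ι_colimitMap F h' ⟨j.1, h j.2⟩

/-- The functor sending a `κ`-directed subset to the colimit of the restriction of `F`. -/
noncomputable def functor : DirectedSubset J κ μ ⥤ C where
  obj S := colimit (restrict F S.1)
  map {S T} f := colimitMap F (leOfHom f)
  map_id S := colimit.hom_ext fun j ↦ by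
    rw [ι_colimitMap, Category.comp_id]
  map_comp f g := (colimitMap_comp F (leOfHom f) (leOfHom g)).symm

/-- The inclusion in the colimit over a `κ`-directed subset. -/
noncomputable def toColim (S : DirectedSubset J κ μ) (j : J) (hj : j ∈ S.1) :
    F.obj j ⟶ (functor F).obj S :=
  colimit.ι (restrict F S.1) ⟨j, hj⟩

lemma map_toColim (S : DirectedSubset J κ μ) {i j : J} (f : i ⟶ j) (hi : i ∈ S.1)
    (hj : j ∈ S.1) : F.map f ≫ toColim F S j hj = toColim F S i hi :=
  colimit.w (restrict F S.1) (j' := ⟨i, hi⟩) (j := ⟨j, hj⟩) (homOfLE (leOfHom f))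

lemma toColim_functor_map {S T : DirectedSubset J κ μ} (f : S ⟶ T) (j : J) (hj : j ∈ S.1) :
    toColim F S j hj ≫ (functor F).map f = toColim F T j (leOfHom f hj) :=
  ι_colimitMap F _ ⟨j, hj⟩

variable {F}

lemma functor_obj_hom_ext (S : DirectedSubset J κ μ) {X : C} {f g : (functor F).obj S ⟶ X}
    (h : ∀ j hj, toColim F S j hj ≫ f = toColim F S j hj ≫ g) : f = g :=
  colimit.hom_ext (F := restrict F S.1) fun j ↦ h j.1 j.2

/-- The morphism from the colimit over a `κ`-directed subset induced by a cocone. -/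
noncomputable def desc (S : DirectedSubset J κ μ) (c : Cocone F) :
    (functor F).obj S ⟶ c.pt :=
  colimit.desc (restrict F S.1)
    { pt := c.pt
      ι.app j := c.ι.app j.1
      ι.naturality _ _ g := c.ι.naturality (homOfLE (leOfHom g)) }

lemma toColim_desc (S : DirectedSubset J κ μ) (c : Cocone F) (j : J) (hj : j ∈ S.1) :
    toColim F S j hj ≫ desc S c = c.ι.app j :=
  colimit.ι_desc (F := restrict F S.1) _ ⟨j, hj⟩

lemma toColim_desc_comp (S : DirectedSubset J κ μ) (c : Cocone F) (j : J) (hj : j ∈ S.1)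
    {X : C} (f : c.pt ⟶ X) : toColim F S j hj ≫ desc S c ≫ f = c.ι.app j ≫ f := by
  rw [← Category.assoc, toColim_desc]

/-- A cocone for `F` induces a cocone for the colimits over `κ`-directed subsets. -/
@[simps]
noncomputable def cocone (c : Cocone F) : Cocone (functor (κ := κ) (μ := μ) F) where
  pt := c.pt
  ι.app S := desc S c
  ι.naturality S T f := functor_obj_hom_ext _ fun j hj ↦ by
    dsimp
    rw [← Category.assoc, toColim_functor_map, toColim_desc, Category.comp_id, toColim_desc]

/-- Two subsets containing `j` lie in a third. This makes the arbitrary choices in `coconeOfCover`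
harmless. -/
lemma toColim_ι_app_eq [IsDirectedOrder (DirectedSubset J κ μ)]
    (s : Cocone (functor (κ := κ) (μ := μ) F)) (S T : DirectedSubset J κ μ) (j : J)
    (hS : j ∈ S.1) (hT : j ∈ T.1) :
    toColim F S j hS ≫ s.ι.app S = toColim F T j hT ≫ s.ι.app T := by
  obtain ⟨U, hSU, hTU⟩ := exists_ge_ge S T
  rw [← s.w (homOfLE hSU), ← s.w (homOfLE hTU), ← Category.assoc, ← Category.assoc,
    toColim_functor_map, toColim_functor_map]

/-- A cocone for the colimits over `κ`-directed subsets induces a cocone for `F`. -/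
noncomputable def coconeOfCover [IsDirectedOrder (DirectedSubset J κ μ)]
    (hJ : ∀ i j : J, i ≤ j → ∃ S : DirectedSubset J κ μ, i ∈ S.1 ∧ j ∈ S.1)
    (s : Cocone (functor (κ := κ) (μ := μ) F)) : Cocone F where
  pt := s.pt
  ι.app j := toColim F _ j (hJ j j le_rfl).choose_spec.1 ≫ s.ι.app _
  ι.naturality i j f := by
    obtain ⟨S, hi, hj⟩ := hJ i j (leOfHom f)
    refine Eq.trans ?_ (Category.comp_id _).symm
    rw [toColim_ι_app_eq s _ S i _ hi, toColim_ι_app_eq s _ S j _ hj, ← Category.assoc,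
      map_toColim F S f hi hj]

/-- If the `κ`-directed subsets of cardinality `< μ` cover `J` and are directed, then a colimit
indexed by `J` is the colimit of the colimits over these subsets. -/
noncomputable def isColimitCocone [IsDirectedOrder (DirectedSubset J κ μ)]
    (hJ : ∀ i j : J, i ≤ j → ∃ S : DirectedSubset J κ μ, i ∈ S.1 ∧ j ∈ S.1)
    {c : Cocone F} (hc : IsColimit c) : IsColimit (cocone (κ := κ) (μ := μ) c) where
  desc s := hc.desc (coconeOfCover hJ s)
  fac s S := functor_obj_hom_ext _ fun j hj ↦
    (toColim_desc_comp S c j hj _).trans ((hc.fac _ j).trans (toColim_ι_app_eq s _ _ _ _ _))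
  uniq s m hm := hc.uniq (coconeOfCover hJ s) m fun j ↦
    (toColim_desc_comp _ c j (hJ j j le_rfl).choose_spec.1 m).symm.trans
      (congrArg (fun f ↦ toColim F _ j _ ≫ f) (hm _))

end DirectedSubset

open DirectedSubset

/-- If all types of cardinality `< μ` have fewer than `μ` subsets of cardinality `< κ`, then any
`κ`-filtered colimit is a `μ`-filtered colimit of `μ`-small `κ`-filtered colimits. -/
lemma ObjectProperty.exists_colimitsOfShape_regroup {κ μ : Cardinal.{w}} [Fact κ.IsRegular]
    [Fact μ.IsRegular] (hκμ : κ < μ)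
    (hμ : ∀ X : Type w, HasCardinalLT X μ →
      HasCardinalLT (CardinalDirectedPoset.SetCardinalLT κ X) μ)
    [HasCardinalFilteredColimits C κ] {P Q : ObjectProperty C}
    (hQ : ∀ (S : Type w) [SmallCategory S] [IsCardinalFiltered S κ],
      HasCardinalLT (Arrow S) μ → P.colimitsOfShape S ≤ Q)
    {J : Type w} [SmallCategory J] [IsCardinalFiltered J κ] {X : C}
    (hX : P.colimitsOfShape J X) :
    ∃ (T : Type w) (_ : SmallCategory T) (_ : IsCardinalFiltered T μ), Q.colimitsOfShape T X := by
  obtain ⟨α, _, _, G, _⟩ := IsCardinalFiltered.exists_cardinal_directed J κ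
  obtain ⟨p⟩ := P.colimitsOfShape_le_of_final G _ hX
  have hα (A : Set α) (hA : HasCardinalLT A μ) :
      ∃ B : Set α, A ⊆ B ∧ IsCardinalFiltered B κ ∧ HasCardinalLT B μ :=
    -- The cofinal family required here is the set of all subsets of cardinality `< κ`, which is
    -- small enough by `hμ`.
    Cardinal.SharplyLT.exists_isCardinalFiltered_set_of_exists_cofinal hκμ
      (fun X hX ↦ ⟨Set.univ, (hμ X hX).of_injective _ Subtype.val_injective,
        fun S ↦ ⟨S, Set.mem_univ _, le_rfl⟩⟩) A hA
  have := DirectedSubset.isCardinalFiltered (κ := κ) (μ := μ) hα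
  have := isFiltered_of_isCardinalFiltered (DirectedSubset α κ μ) μ
  have : IsDirectedOrder (DirectedSubset α κ μ) := IsFiltered.isDirectedOrder _
  refine ⟨DirectedSubset α κ μ, inferInstance, inferInstance, ⟨
    { diag := functor p.diag
      ι := (cocone p.cocone).ι
      isColimit := isColimitCocone (fun i j _ ↦ ?_) p.isColimit
      prop_diag_obj S := ?_ }⟩⟩
  · obtain ⟨B, hB, h₁, h₂⟩ := hα {i, j}
      (hasCardinalLT_of_finite _ _ (Cardinal.IsRegular.aleph0_le Fact.out))
    exact ⟨⟨B, h₁, h₂⟩, hB (by simp), hB (by simp)⟩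
  · exact hQ S.1 S.hasCardinalLT_arrow _
      ⟨.colimit (restrict p.diag S.1) fun j ↦ p.prop_diag_obj _⟩

/-- A `κ`-directed partially ordered type covered by fewer than `κ` subsets
has a cofinal subset among them. -/
lemma exists_cofinal_of_iUnion_eq_univ {κ : Cardinal.{w}} [Fact κ.IsRegular] {J : Type w}
    [PartialOrder J] [IsCardinalFiltered J κ] {I : Type w} (hI : HasCardinalLT I κ)
    (A : I → Set J) (hA : ∀ j, ∃ i, j ∈ A i) : ∃ i, ∀ j, ∃ k ∈ A i, j ≤ k := by
  by_contra! h
  choose j hj using h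
  -- If every `A i` had a witness `j i` against cofinality, a common upper bound of these witnesses
  -- would lie in some `A i`, a contradiction.
  obtain ⟨i, hi⟩ := hA (IsCardinalFiltered.max j hI)
  exact hj i _ hi (leOfHom (IsCardinalFiltered.toMax j hI i))

lemma isCardinalFiltered_of_cofinal {κ : Cardinal.{w}} [Fact κ.IsRegular] {J : Type w}
    [PartialOrder J] [IsCardinalFiltered J κ] (A : Set J) (hA : ∀ j, ∃ k ∈ A, j ≤ k) :
    IsCardinalFiltered A κ :=
  isCardinalFiltered_preorder _ _ fun K s hK ↦ by
    rw [← hasCardinalLT_iff_cardinal_mk_lt] at hK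
    obtain ⟨k, hk, h⟩ := hA (IsCardinalFiltered.max (fun k ↦ (s k).1) hK)
    exact ⟨⟨k, hk⟩, fun i ↦
      (leOfHom (IsCardinalFiltered.toMax (fun k ↦ (s k).1) hK i)).trans h⟩

/-! ### Full subcategories closed under filtered colimits -/

namespace ObjectProperty

/-- A union of fewer than `κ` properties closed under `κ`-filtered colimits is closed
under `κ`-filtered colimits. -/
lemma isClosedUnderColimitsOfShape_iSup {κ : Cardinal.{w}} [Fact κ.IsRegular] {I : Type w}
    (hI : HasCardinalLT I κ) (P : I → ObjectProperty C)
    (hP : ∀ (i : I) (J : Type w) [SmallCategory J] [IsCardinalFiltered J κ],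
      (P i).IsClosedUnderColimitsOfShape J)
    (J : Type w) [SmallCategory J] [IsCardinalFiltered J κ] :
    (⨆ i, P i : ObjectProperty C).IsClosedUnderColimitsOfShape J where
  colimitsOfShape_le X hX := by
    obtain ⟨α, _, _, G, _⟩ := IsCardinalFiltered.exists_cardinal_directed J κ
    obtain ⟨p⟩ := colimitsOfShape_le_of_final _ G _ hX
    obtain ⟨i, hi⟩ := exists_cofinal_of_iUnion_eq_univ hI
      (fun i ↦ { j | P i (p.diag.obj j) }) fun j ↦ by simpa using p.prop_diag_obj j
    have := isCardinalFiltered_of_cofinal (κ := κ) _ hi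
    have := isFiltered_of_isCardinalFiltered { j | P i (p.diag.obj j) } κ
    have : IsDirectedOrder { j | P i (p.diag.obj j) } := IsFiltered.isDirectedOrder _
    have hmono : Monotone (fun j : { j | P i (p.diag.obj j) } ↦ j.1) := fun _ _ h ↦ h
    have : hmono.functor.Final := hmono.final_functor_iff.2 fun j ↦ by
      obtain ⟨k, hk, h⟩ := hi j
      exact ⟨⟨k, hk⟩, h⟩
    have := hP i { j | P i (p.diag.obj j) }
    have hX : P i X := (P i).colimitsOfShape_le { j | P i (p.diag.obj j) } _
      ⟨{ toColimitPresentation := p.toColimitPresentation.reindex hmono.functor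
         prop_diag_obj := fun j ↦ j.2 }⟩
    simpa using ⟨i, hX⟩

lemma essentiallySmall_inverseImage_ι (U P : ObjectProperty C)
    [ObjectProperty.EssentiallySmall.{w} P] :
    ObjectProperty.EssentiallySmall.{w} (P.inverseImage U.ι) where
  exists_small_le' := by
    -- Representatives of `P` alone might fall outside `U`.
    have : ObjectProperty.EssentiallySmall.{w} (P ⊓ U) := .of_le (Q := P) inf_le_left
    obtain ⟨Q, _, hQ, hQ'⟩ := EssentiallySmall.exists_small_le (P ⊓ U)
    refine ⟨Q.inverseImage U.ι, small_of_injective (β := Subtype Q)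
      (f := fun X ↦ ⟨X.1.obj, X.2⟩) fun X Y h ↦ ?_, fun X hX ↦ ?_⟩
    · exact Subtype.ext (FullSubcategory.ext (congrArg Subtype.val h))
    · obtain ⟨Y, hY, ⟨e⟩⟩ := hQ' _ ⟨hX, X.2⟩
      exact ⟨⟨Y, (hQ _ hY).2⟩, hY, ⟨U.ι.preimageIso e⟩⟩

/-- An object of a full subcategory closed under `κ`-filtered colimits is `κ`-presentable if it is
so in the ambient category. -/
lemma isCardinalPresentable_of_ι {κ : Cardinal.{w}} [Fact κ.IsRegular] (U : ObjectProperty C)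
    (hU : ∀ (J : Type w) [SmallCategory J] [IsCardinalFiltered J κ],
      U.IsClosedUnderColimitsOfShape J)
    [HasCardinalFilteredColimits C κ] (X : U.FullSubcategory) [IsCardinalPresentable X.obj κ] :
    IsCardinalPresentable X κ where
  preservesColimitOfShape J _ _ := by
    have := hU J
    have := HasCardinalFilteredColimits.hasColimitsOfShape C (κ := κ) J
    have := preservesColimitsOfShape_of_isCardinalPresentable X.obj κ J
    exact preservesColimitsOfShape_of_natIso
      (F := U.ι ⋙ coyoneda.obj (.op X.obj))
      (NatIso.ofComponents fun Y ↦ (U.fullyFaithfulι.homEquiv (X := X) (Y := Y)).symm.toIso)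

/-- A colimit in a full subcategory closed under `κ`-filtered colimits is a colimit in the
ambient category. -/
lemma colimitsOfShape_strictMap_ι (U : ObjectProperty C) (J : Type w) [SmallCategory J]
    [HasColimitsOfShape J C] [U.IsClosedUnderColimitsOfShape J]
    {P : ObjectProperty U.FullSubcategory} {X : U.FullSubcategory}
    (hX : P.colimitsOfShape J X) : (P.strictMap U.ι).colimitsOfShape J X.obj := by
  obtain ⟨p⟩ := hX
  exact ⟨{ toColimitPresentation := p.toColimitPresentation.map U.ι
           prop_diag_obj j := ⟨_, p.prop_diag_obj j⟩ }⟩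

/-- A colimit of objects in a full subcategory, with point in this full subcategory, is a colimit
in the full subcategory. -/
lemma colimitsOfShape_inverseImage_ι (U : ObjectProperty C) (J : Type w) [SmallCategory J]
    {P : ObjectProperty C} (hP : P ≤ U) {X : U.FullSubcategory}
    (hX : P.colimitsOfShape J X.obj) : (P.inverseImage U.ι).colimitsOfShape J X := by
  obtain ⟨p⟩ := hX
  exact ⟨
    { diag := U.lift p.diag fun j ↦ hP _ (p.prop_diag_obj j)
      ι :=
        { app j := homMk (p.ι.app j)
          naturality i j f := by
            ext
            exact p.ι.naturality f }
      isColimit := isColimitOfReflects U.ι p.isColimit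
      prop_diag_obj := p.prop_diag_obj }⟩

end ObjectProperty

lemma HasCardinalFilteredColimits.of_le {κ μ : Cardinal.{w}} [Fact κ.IsRegular] [Fact μ.IsRegular]
    [HasCardinalFilteredColimits C κ] (h : κ ≤ μ) : HasCardinalFilteredColimits C μ where
  hasColimitsOfShape J _ _ :=
    have := IsCardinalFiltered.of_le J h
    HasCardinalFilteredColimits.hasColimitsOfShape C (κ := κ) J

/-! ### Uniform cardinals and accessibility of the union -/

namespace ObjectProperty

/-- Any essentially small property of presentable objects consists of `κ`-presentable
objects for all large enough `κ`. -/
lemma exists_le_isCardinalPresentable (P : ObjectProperty C)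
    [ObjectProperty.EssentiallySmall.{w} P] (hP : ∀ X, P X → IsPresentable.{w} X) :
    ∃ c : Cardinal.{w}, ∀ (μ : Cardinal.{w}) [Fact μ.IsRegular], c ≤ μ →
      P ≤ isCardinalPresentable C μ := by
  obtain ⟨R, _, hR, hPR⟩ := EssentiallySmall.exists_small_le P
  choose r hr hr' using fun X : Subtype R ↦ (hP X.1 (hR _ X.2)).exists_cardinal
  refine ⟨⨆ X, r X, fun μ _ hμ ↦ hPR.trans ?_⟩
  rw [isoClosure_le_iff]
  intro X hX
  have := hr ⟨X, hX⟩
  have := hr' ⟨X, hX⟩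
  exact (coyoneda.obj (.op X)).isCardinalAccessible_of_le
    ((le_ciSup Cardinal.bddAbove_of_small (⟨X, hX⟩ : Subtype R)).trans hμ)

/-- An accessible and accessibly embedded full subcategory is closed under `κ`-filtered
colimits for an arbitrarily large `κ` such that all its objects are `κ`-filtered colimits in the
ambient category of objects from an essentially small collection. -/
lemma IsAccessiblyEmbedded.exists_essentiallySmall {U : ObjectProperty C}
    (hU : IsAccessiblyEmbedded.{w} U) [IsAccessibleCategory.{w} U.FullSubcategory]
    (κ₀ : Cardinal.{w}) [Fact κ₀.IsRegular] [HasCardinalFilteredColimits C κ₀] :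
    ∃ (κ : Cardinal.{w}) (_ : Fact κ.IsRegular), κ₀ ≤ κ ∧
      (∀ (J : Type w) [SmallCategory J] [IsCardinalFiltered J κ],
        U.IsClosedUnderColimitsOfShape J) ∧
      ∃ (P : ObjectProperty C), ObjectProperty.EssentiallySmall.{w} P ∧ P ≤ U ∧
        ∀ X, U X → ∃ (J : Type w) (_ : SmallCategory J) (_ : IsCardinalFiltered J κ),
          P.colimitsOfShape J X := by
  obtain ⟨κ₁, _, hκ₁⟩ := hU
  obtain ⟨κ₂, _, _⟩ := IsAccessibleCategory.exists_cardinal.{w} U.FullSubcategory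
  obtain ⟨P, _, hP⟩ := HasCardinalFilteredGenerator.exists_generator U.FullSubcategory κ₂
  let c := max κ₀ (max κ₁ κ₂)
  let κ : Cardinal.{w} := Order.succ (2 ^ max c Cardinal.aleph0)
  have : Fact κ.IsRegular := ⟨Cardinal.isRegular_succ_two_power c⟩
  have h₀ : κ₀ ≤ κ := (le_max_left _ _).trans (Cardinal.lt_succ_two_power c).le
  have h₁ : κ₁ ≤ κ := ((le_max_left _ _).trans (le_max_right _ _)).trans
    (Cardinal.lt_succ_two_power c).le
  have h₂ : κ₂ ≤ c := (le_max_right _ _).trans (le_max_right _ _)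
  have hUκ (J : Type w) [SmallCategory J] [IsCardinalFiltered J κ] :
      U.IsClosedUnderColimitsOfShape J :=
    have := IsCardinalFiltered.of_le J h₁
    hκ₁ J
  have : HasCardinalFilteredColimits C κ := .of_le h₀
  refine ⟨κ, inferInstance, h₀, hUκ, (P.colimitsCardinalClosure κ).strictMap U.ι,
    .of_le (strictMap_le_map _ _), ?_, fun X hX ↦ ?_⟩
  · rintro _ ⟨Y, _⟩
    exact Y.property
  · obtain ⟨J, _, _, hJ⟩ := hP.exists_colimitsOfShape ⟨X, hX⟩
    -- The inclusion need not preserve `κ₂`-filtered colimits, so the regrouping takes place inside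
    -- the subcategory; only the outer `κ`-filtered colimit is then transported to `C`.
    obtain ⟨T, _, _, hT⟩ := exists_colimitsOfShape_regroup
      (h₂.trans_lt (Cardinal.lt_succ_two_power c))
      (fun _ ↦ Cardinal.hasCardinalLT_setCardinalLT_succ_two_power h₂)
      (fun S _ _ hS ↦ (colimitsOfShape_monotone S (P.le_colimitsCardinalClosure κ)).trans
        (P.isClosedUnderColimitsOfShape_colimitsCardinalClosure κ S hS).colimitsOfShape_le) hJ
    have := hUκ T
    have := HasCardinalFilteredColimits.hasColimitsOfShape C (κ := κ) T
    exact ⟨T, inferInstance, inferInstance, U.colimitsOfShape_strictMap_ι T hT⟩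

end ObjectProperty

open ObjectProperty

/-- Let `U` be the union of a family of properties `L i` closed under `κ i`-filtered colimits
and such that all objects satisfying `L i` are `κ i`-filtered colimits of objects from an
essentially small collection `P i`. Then, `U` is accessible. -/
lemma isAccessibleCategory_fullSubcategory_iSup [LocallySmall.{w} C]
    (hC : ∀ X : C, IsPresentable.{w} X) {κ₀ : Cardinal.{w}} [Fact κ₀.IsRegular]
    [HasCardinalFilteredColimits C κ₀] {I : Type w} (L : I → ObjectProperty C)
    (κ : I → Cardinal.{w}) [∀ i, Fact (κ i).IsRegular] (hκ : ∀ i, κ₀ ≤ κ i)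
    (hL : ∀ (i : I) (J : Type w) [SmallCategory J] [IsCardinalFiltered J (κ i)],
      (L i).IsClosedUnderColimitsOfShape J)
    (P : I → ObjectProperty C) [∀ i, ObjectProperty.EssentiallySmall.{w} (P i)]
    (hPL : ∀ i, P i ≤ L i)
    (hP : ∀ i X, L i X → ∃ (J : Type w) (_ : SmallCategory J) (_ : IsCardinalFiltered J (κ i)),
      (P i).colimitsOfShape J X) :
    IsAccessibleCategory.{w} (⨆ i, L i : ObjectProperty C).FullSubcategory ∧
      IsAccessiblyEmbedded.{w} (⨆ i, L i : ObjectProperty C) := by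
  let U : ObjectProperty C := ⨆ i, L i
  obtain ⟨c₀, hc₀⟩ := exists_le_isCardinalPresentable (⨆ i, P i) fun X _ ↦ hC X
  -- The four terms provide colimits in `C`, presentability of the `P i`, the cofinality argument
  -- over `I`, and regrouping for every `κ i`.
  let c := max (max κ₀ c₀) (max (Cardinal.mk I) (⨆ i, κ i))
  let μ : Cardinal.{w} := Order.succ (2 ^ max c Cardinal.aleph0)
  have : Fact μ.IsRegular := ⟨Cardinal.isRegular_succ_two_power c⟩
  have hcμ : c < μ := Cardinal.lt_succ_two_power c
  have hκc (i : I) : κ i ≤ c := (le_ciSup Cardinal.bddAbove_of_small i).trans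
    ((le_max_right _ _).trans (le_max_right _ _))
  have hI : HasCardinalLT I μ := (hasCardinalLT_iff_cardinal_mk_lt _ _).2
    (((le_max_left _ _).trans (le_max_right _ _)).trans_lt hcμ)
  have hPμ : (⨆ i, P i) ≤ isCardinalPresentable C μ :=
    hc₀ μ (((le_max_right _ _).trans (le_max_left _ _)).trans hcμ.le)
  have : HasCardinalFilteredColimits C μ :=
    .of_le (((le_max_left κ₀ _).trans (le_max_left _ _)).trans hcμ.le)
  have hU (J : Type w) [SmallCategory J] [IsCardinalFiltered J μ] :
      U.IsClosedUnderColimitsOfShape J :=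
    isClosedUnderColimitsOfShape_iSup hI L (fun i J _ _ ↦
      have := IsCardinalFiltered.of_le J ((hκc i).trans hcμ.le)
      hL i J) J
  -- Small colimits can leave the union, hence the intersection with `U`; the closure gives
  -- smallness and presentability.
  let Q : ObjectProperty C := (⨆ i, P i).colimitsCardinalClosure μ ⊓ U
  have : ObjectProperty.EssentiallySmall.{w} Q :=
    .of_le (Q := (⨆ i, P i).colimitsCardinalClosure μ) inf_le_left
  have hQμ : Q ≤ isCardinalPresentable C μ := inf_le_left.trans
    (colimitsCardinalClosure_le _ _
      (fun _ _ hJ ↦ isClosedUnderColimitsOfShape_isCardinalPresentable C hJ) hPμ)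
  have hQ : (Q.inverseImage U.ι).IsCardinalFilteredGenerator μ :=
    { le_isCardinalPresentable X hX :=
        have : IsCardinalPresentable X.obj μ := hQμ _ hX
        isCardinalPresentable_of_ι U hU X
      exists_colimitsOfShape X := by
        obtain ⟨i, hi⟩ : ∃ i, L i X.obj := by simpa [U] using X.property
        obtain ⟨J, _, _, hJ⟩ := hP i _ hi
        have : HasCardinalFilteredColimits C (κ i) := .of_le (hκ i)
        obtain ⟨T, _, _, hT⟩ := exists_colimitsOfShape_regroup (Q := Q)
          ((hκc i).trans_lt hcμ)
          (fun _ ↦ Cardinal.hasCardinalLT_setCardinalLT_succ_two_power (hκc i))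
          (fun S _ _ hS ↦ le_inf
            ((colimitsOfShape_monotone S
              ((le_iSup P i).trans (le_colimitsCardinalClosure _ μ))).trans
              (isClosedUnderColimitsOfShape_colimitsCardinalClosure _ μ S hS).colimitsOfShape_le)
            ((colimitsOfShape_monotone S (hPL i)).trans
              ((hL i S).colimitsOfShape_le.trans (le_iSup L i)))) hJ
        exact ⟨T, inferInstance, inferInstance,
          colimitsOfShape_inverseImage_ι U T inf_le_right hT⟩ }
  have := essentiallySmall_inverseImage_ι U Q
  have := hQ.hasCardinalFilteredGenerator
  have : HasCardinalFilteredColimits U.FullSubcategory μ :=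
    { hasColimitsOfShape J _ _ :=
        have := hU J
        have := HasCardinalFilteredColimits.hasColimitsOfShape C (κ := μ) J
        inferInstance }
  exact ⟨⟨μ, inferInstance, { }⟩, μ, inferInstance, hU⟩

end CategoryTheory

theorem proposition2p1 {K : Type u} [Category.{v} K] [IsAccessibleCategory.{w} K]
    {I : Type w} (L : I → ObjectProperty K)
    (hacc : ∀ i, IsAccessibleCategory.{w} (L i).FullSubcategory)
    (hemb : ∀ i, ObjectProperty.IsAccessiblyEmbedded.{w} (L i)) :
    IsAccessibleCategory.{w} (⨆ i, L i : ObjectProperty K).FullSubcategory ∧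
      ObjectProperty.IsAccessiblyEmbedded.{w} (⨆ i, L i : ObjectProperty K) := by
  obtain ⟨κ₀, _, _⟩ := IsAccessibleCategory.exists_cardinal.{w} K
  choose κ hκ hκ₀ hL P hP hPL hLP using fun i ↦ (hemb i).exists_essentiallySmall κ₀
  exact isAccessibleCategory_fullSubcategory_iSup (fun X ↦ inferInstance) L κ hκ₀ hL P hPL hLP
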